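/- Let $\Omega\subset\mathbb R^2$ be a quasidisk, i.e. a bounded domain whose boundary $\Gamma=\partial\Omega$ is a Jordan curve that is the image of the unit circle under a $K$-quasiconformal homeomorphism $f$ of $\mathbb R^2$ for some $K\ge 1$ (an orientation-preserving homeomorphism in $W^{1,2}_{\mathrm{loc}}$ with $|Df|^2\le K J_f$ almost everywhere). Suppose that $\Gamma$ is not a chord-arc curve, i.e. it is not the case that $\Gamma$ is rectifiable and there is a constant $c>1$ such that for all $x,y\in\Gamma$ the shorter of the two subarcs of $\Gamma$ with endpoints $x,y$ has length at most $c|x-y|$. Then there is a homeomorphism $\varphi\colon[0,\infty)\to[0,\infty)$ with $\varphi(0)=0$, $\liminf_{t\to0^+}\varphi(t)/t>0$ (the value $+\infty$ being allowed), and $\varphi$ Lipschitz on $[r,\infty)$ for every $r>0$, such that the surface $$\Sigma(\Omega,\varphi)=\{(x,z)\colon x\in\overline\Omega,\ z=\pm\varphi(\operatorname{dist}(x,\partial\Omega))\}\subset\mathbb R^3,$$ with the Euclidean metric, is not quasisymmetric to the unit sphere $\mathbb S^2\subset\mathbb R^3$; that is, there are no homeomorphism $h\colon\Sigma(\Omega,\varphi)\to\mathbb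 S^2$ and homeomorphism $\eta\colon[0,\infty)\to[0,\infty)$ such that for all $x,a,b\in\Sigma(\Omega,\varphi)$ and $t>0$ the inequality $|x-a|\le t|x-b|$ implies $|h(x)-h(a)|\le\eta(t)|h(x)-h(b)|$. -/

import Mathlib

open MeasureTheory Filter Topology Set
open scoped NNReal ENNReal ContDiff

noncomputable section

namespace DoubleDome

/-- The Euclidean plane `ℝ²`. -/
abbrev Plane : Type := EuclideanSpace ℝ (Fin 2)

/-- Euclidean three-space `ℝ³`. -/
abbrev Space : Type := EuclideanSpace ℝ (Fin 3)

/-- `f` restricted to `[0,1]` is a simple closed parametrization of the planar set `γ`. -/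
structure IsJordanParam (f : ℝ → Plane) (γ : Set Plane) : Prop where
  continuousOn : ContinuousOn f (Icc 0 1)
  injOn : InjOn f (Ico 0 1)
  closed : f 0 = f 1
  image_eq : f '' Icc 0 1 = γ

/-- A planar Jordan curve. -/
def IsJordanCurve (γ : Set Plane) : Prop := ∃ f : ℝ → Plane, IsJordanParam f γ

/-- A planar Jordan domain: a bounded domain whose boundary is a Jordan curve. -/
structure IsJordanDomain (Ω : Set Plane) : Prop where
  isOpen : IsOpen Ω
  isConnected : IsConnected Ω
  isBounded : Bornology.IsBounded Ω
  isJordanCurve : IsJordanCurve (frontier Ω)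

/-- `Du` is the weak (distributional) derivative of `u` on the plane, and both `u` and `Du` are
locally square integrable; that is, `u ∈ W^{1,2}_loc` with weak derivative `Du`. -/
structure HasSobolevDeriv (u : Plane → Plane) (Du : Plane → Plane →L[ℝ] Plane) : Prop where
  memLp : ∀ S : Set Plane, IsCompact S → MemLp u 2 (volume.restrict S)
  memLp_deriv : ∀ S : Set Plane, IsCompact S → MemLp Du 2 (volume.restrict S)
  integral_eq : ∀ ψ : Plane → ℝ, ContDiff ℝ ∞ ψ → HasCompactSupport ψ → ∀ v : Plane,
    ∫ x, fderiv ℝ ψ x v • u x = -∫ x, ψ x • Du x v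

/-- A homeomorphism of the plane is `K`-quasiconformal: it lies in `W^{1,2}_loc` and satisfies
`|Df|² ≤ K J_f` almost everywhere, with the signed Jacobian `J_f` (an orientation reversing
homeomorphism in `W^{1,2}_loc` has `J_f ≤ 0` almost everywhere, so it never satisfies this
inequality: orientation preservation is part of the condition). -/
def IsQuasiconformal (K : ℝ) (f : Plane ≃ₜ Plane) : Prop :=
  ∃ Df : Plane → Plane →L[ℝ] Plane, HasSobolevDeriv f Df ∧
    ∀ᵐ x : Plane, ‖Df x‖ ^ 2 ≤ K * (Df x).det

/-- A planar quasicircle: the image of the unit circle under a quasiconformal homeomorphism of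
the plane. -/
def IsQuasicircle (γ : Set Plane) : Prop :=
  ∃ (K : ℝ) (f : Plane ≃ₜ Plane), 1 ≤ K ∧ IsQuasiconformal K f ∧
    f '' Metric.sphere (0 : Plane) 1 = γ

/-- A quasidisk: a Jordan domain bounded by a quasicircle. -/
def IsQuasidisk (Ω : Set Plane) : Prop := IsJordanDomain Ω ∧ IsQuasicircle (frontier Ω)

/-- A chord-arc curve: a rectifiable Jordan curve for which there is `c > 1` such that for any two
of its points the shorter of the two subarcs between them has length at most `c` times their
distance. The points `f s`, `f t` (`s ≤ t`) cut the curve into `f '' [s,t]` and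
`f '' ([t,1] ∪ [0,s])`; lengths are variations of the parametrization. -/
def IsChordArcCurve (γ : Set Plane) : Prop :=
  ∃ f : ℝ → Plane, IsJordanParam f γ ∧ eVariationOn f (Icc 0 1) ≠ ⊤ ∧
    ∃ c : ℝ, 1 < c ∧ ∀ s t : ℝ, 0 ≤ s → s ≤ t → t ≤ 1 →
      min (eVariationOn f (Icc s t)) (eVariationOn f (Icc t 1) + eVariationOn f (Icc 0 s))
        ≤ ENNReal.ofReal (c * dist (f s) (f t))

/-- The class of gauges: homeomorphisms `φ` of `[0,∞)` with `φ(0) = 0`,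
`liminf_{t → 0+} φ(t)/t > 0` (the value `∞` is allowed), and `φ` Lipschitz on `[r,∞)` for
every `r > 0`. -/
structure IsGauge (φ : ℝ≥0 ≃ₜ ℝ≥0) : Prop where
  map_zero : φ 0 = 0
  liminf_pos : 0 < liminf (fun t : ℝ≥0 => (φ t : ℝ≥0∞) / (t : ℝ≥0∞)) (𝓝[>] 0)
  lipschitzOn : ∀ r : ℝ≥0, 0 < r → ∃ L : ℝ≥0, LipschitzOnWith L φ (Ici r)

/-- The double-dome-like surface
`Σ(Ω,φ) = {(x,z) : x ∈ closure Ω, z = ± φ(dist(x,∂Ω))}` in `ℝ³`. -/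
def surface (Ω : Set Plane) (φ : ℝ≥0 ≃ₜ ℝ≥0) : Set Space :=
  {p | ∃ x ∈ closure Ω, p 0 = x 0 ∧ p 1 = x 1 ∧
    (p 2 = φ (Metric.infNndist x (frontier Ω)) ∨ p 2 = -(φ (Metric.infNndist x (frontier Ω)) : ℝ))}

/-- `f` is a quasisymmetric homeomorphism: it is `η`-quasisymmetric for some
homeomorphism `η` of `[0,∞)`. -/
def IsQuasisymmetric {X Y : Type*} [MetricSpace X] [MetricSpace Y] (f : X ≃ₜ Y) : Prop :=
  ∃ η : ℝ≥0 ≃ₜ ℝ≥0, ∀ (x a b : X) (t : ℝ≥0), 0 < t → dist x a ≤ t * dist x b →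
    dist (f x) (f a) ≤ η t * dist (f x) (f b)

/-- The metric space `X` is quasisymmetric to (is the image under a quasisymmetric homeomorphism
onto) the metric space `Y`. -/
def QuasisymmetricTo (X Y : Type*) [MetricSpace X] [MetricSpace Y] : Prop :=
  ∃ f : X ≃ₜ Y, IsQuasisymmetric f

end DoubleDome

end

namespace DoubleDome

/-! ### Gauges that grow fast along a prescribed sequence -/

/-! The gauge may be arbitrarily steep at the origin: for any positive `δ n` there is a gauge with
`φ (δ n) ≥ 2⁻ⁿ` (`exists_gauge`). Each `δ n` is chosen from the geometry of `Γ = ∂Ω` at one scale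
below `2⁻ⁿ`, and at that scale the surface looks like a vertical wall over `Γ`. It then suffices
that `Γ` have bad geometry at such scales for every `n`; there are two kinds.

If `HasWideArcs` holds for every `n`, both arcs between some `x, y ∈ Γ` travel much farther than
`n|x - y|`. A connected subset of the surface joining them either travels far too or crosses the
interior of `Ω`, where the wall is too high. A quasisymmetric image of the sphere is linearly
connected, which excludes this (`exists_delta_turning`).

If `HasLargePacking` holds for every `n`, some ball of radius `d` contains more than `n d / s`
points of `Γ` that are `s`-separated. The wall over them carries a grid of about `d / s` rows and
far more columns. A length-area estimate on the sphere bounds the number of columns by a constant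
times `d / s` (`card_le_of_columns`, `exists_delta_packing`).

If both conditions fail for some index, the failure of packing gives `μH[1] (Γ ∩ B(p,d)) ≤ M d`, and
the failure of wide arcs places one arc between `x` and `y` in a ball of radius `L|x - y|`. Its
length is then at most a multiple of `|x - y|`, so `Γ` is chord-arc
(`IsJordanParam.isChordArcCurve`). -/

theorem isGauge_of_lipschitz (φ : ℝ≥0 ≃ₜ ℝ≥0) (h0 : φ 0 = 0) (hle : ∀ t, t ≤ φ t)
    (hL : ∀ r : ℝ≥0, 0 < r → ∃ L : ℝ≥0, LipschitzOnWith L φ (Ici r)) : IsGauge φ where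
  map_zero := h0
  lipschitzOn := hL
  liminf_pos := by
    refine lt_of_lt_of_le zero_lt_one (le_liminf_of_le (by isBoundedDefault) ?_)
    filter_upwards [self_mem_nhdsWithin] with t ht
    have ht' : (t : ℝ≥0∞) ≠ 0 := by simpa using (ne_of_gt ht : t ≠ 0)
    rw [ENNReal.le_div_iff_mul_le (Or.inl ht') (Or.inl ENNReal.coe_ne_top), one_mul]
    exact_mod_cast hle t

/-- The ramp of height `2⁻ⁿ` and width `δ`. -/
noncomputable def ramp (δ : ℕ → ℝ≥0) (n : ℕ) (t : ℝ) : ℝ := (1 / 2) ^ n * min 1 (t / δ n)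

theorem ramp_nonneg (δ : ℕ → ℝ≥0) (n : ℕ) {t : ℝ} (ht : 0 ≤ t) : 0 ≤ ramp δ n t := by
  unfold ramp; positivity

theorem ramp_le (δ : ℕ → ℝ≥0) (n : ℕ) (t : ℝ) : ramp δ n t ≤ (1 / 2) ^ n :=
  mul_le_of_le_one_right (by positivity) (min_le_left _ _)

theorem ramp_mono (δ : ℕ → ℝ≥0) (n : ℕ) : Monotone (ramp δ n) := by
  intro s t h
  unfold ramp
  gcongr

theorem summable_ramp (δ : ℕ → ℝ≥0) {t : ℝ} (ht : 0 ≤ t) : Summable fun n => ramp δ n t :=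
  Summable.of_nonneg_of_le (fun n => ramp_nonneg δ n ht) (fun n => ramp_le δ n t)
    summable_geometric_two

/-- The ramp is constant beyond `δ n`, and it rises on `[r,∞)` only if `δ n ≥ r`, with slope at most
`2⁻ⁿ / r`. The bound does not depend on `δ`, so the sum of the ramps is Lipschitz on `[r,∞)` for
every choice of `δ`. -/
theorem ramp_sub_le {δ : ℕ → ℝ≥0} (hδ : ∀ n, 0 < δ n) (n : ℕ) {r s t : ℝ} (hr : 0 < r)
    (hs : r ≤ s) (hst : s ≤ t) : ramp δ n t ≤ ramp δ n s + (1 / 2) ^ n * ((t - s) / r) := by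
  have hd : (0 : ℝ) < δ n := hδ n
  unfold ramp
  rw [← mul_add]
  refine mul_le_mul_of_nonneg_left ?_ (by positivity)
  have h0 : 0 ≤ (t - s) / r := div_nonneg (by linarith) hr.le
  rcases le_total 1 (s / δ n) with h | h
  · rw [min_eq_left h]
    linarith [min_le_left 1 (t / δ n)]
  · rw [min_eq_right h]
    rw [div_le_one hd] at h
    refine (min_le_right _ _).trans ?_
    have : (t - s) / δ n ≤ (t - s) / r :=
      div_le_div_of_nonneg_left (by linarith) hr (hs.trans h)
    calc t / δ n = s / δ n + (t - s) / δ n := by ring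
      _ ≤ _ := by linarith

/-- There is a gauge that is at least `2⁻ⁿ` at `δ n`, however small the numbers `δ n` are. -/
theorem exists_gauge (δ : ℕ → ℝ≥0) (hδ : ∀ n, 0 < δ n) :
    ∃ φ : ℝ≥0 ≃ₜ ℝ≥0, IsGauge φ ∧ StrictMono φ ∧ ∀ n, (1 / 2 : ℝ) ^ n ≤ φ (δ n) := by
  set g : ℝ≥0 → ℝ := fun t => ∑' n, ramp δ n t with hg
  have g0 : ∀ t, 0 ≤ g t := fun t => tsum_nonneg fun n => ramp_nonneg δ n t.coe_nonneg
  have gmono : Monotone g := fun s t h =>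
    (summable_ramp δ s.coe_nonneg).tsum_le_tsum (fun n => ramp_mono δ n h) (summable_ramp δ t.coe_nonneg)
  have gcont : Continuous g := by
    refine continuous_tsum (u := fun n : ℕ => (1 / 2 : ℝ) ^ n) (fun n => ?_)
      summable_geometric_two fun n t => ?_
    · unfold ramp; fun_prop
    · rw [Real.norm_of_nonneg (ramp_nonneg δ n t.coe_nonneg)]
      exact ramp_le δ n t
  have gzero : g 0 = 0 := by simp [hg, ramp]
  have glip : ∀ r s t : ℝ≥0, 0 < r → r ≤ s → s ≤ t →
      g t ≤ g s + 2 * (((t : ℝ) - s) / r) := by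
    intro r s t hr hs hst
    have hsum : Summable fun n : ℕ => (1 / 2 : ℝ) ^ n * (((t : ℝ) - s) / r) :=
      summable_geometric_two.mul_right _
    calc g t ≤ ∑' n, (ramp δ n s + (1 / 2) ^ n * (((t : ℝ) - s) / r)) :=
          (summable_ramp δ t.coe_nonneg).tsum_le_tsum
            (fun n => ramp_sub_le hδ n (by exact_mod_cast hr) hs hst)
            ((summable_ramp δ s.coe_nonneg).add hsum)
      _ = _ := by
          rw [(summable_ramp δ s.coe_nonneg).tsum_add hsum, tsum_mul_right, tsum_geometric_two]
  -- The summand `t` makes `F` strictly increasing and unbounded, and gives `t ≤ F t`, hence a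
  -- positive lower limit.
  let F : ℝ≥0 → ℝ≥0 := fun t => t + ⟨g t, g0 t⟩
  have Fcont : Continuous F := continuous_id.add (gcont.subtype_mk _)
  have Fmono : StrictMono F := fun s t h => add_lt_add_of_lt_of_le h (gmono h.le)
  have F0 : F 0 = 0 := by
    apply NNReal.eq
    change ((0 : ℝ≥0) : ℝ) + g 0 = 0
    rw [gzero, NNReal.coe_zero, add_zero]
  have Fle : ∀ t, t ≤ F t := fun t => le_self_add
  have Fsurj : Function.Surjective F := by
    intro y
    have := intermediate_value_Icc (zero_le : 0 ≤ y) Fcont.continuousOn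
    obtain ⟨x, -, hx⟩ := this ⟨by rw [F0]; exact zero_le, Fle y⟩
    exact ⟨x, hx⟩
  let φ : ℝ≥0 ≃ₜ ℝ≥0 := (Fmono.orderIsoOfSurjective F Fsurj).toHomeomorph
  have φF : ∀ t, φ t = F t := fun t => rfl
  refine ⟨φ, isGauge_of_lipschitz φ F0 Fle ?_, Fmono, fun n => ?_⟩
  · intro r hr
    refine ⟨1 + 2 / r, LipschitzOnWith.of_dist_le_mul ?_⟩
    have key : ∀ s t : ℝ≥0, r ≤ s → s ≤ t → dist (φ s) (φ t) ≤ (1 + 2 / r : ℝ≥0) * dist s t := by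
      intro s t hs hst
      have h1 := glip r s t hr hs hst
      have h2 := gmono hst
      have h3 : (s : ℝ) ≤ t := hst
      rw [φF, φF, dist_comm, dist_comm s, NNReal.dist_eq, NNReal.dist_eq, abs_of_nonneg
        (by linarith : (0 : ℝ) ≤ t - s), abs_of_nonneg (sub_nonneg.2 (NNReal.coe_le_coe.2 (Fmono.monotone hst)))]
      change (t : ℝ) + g t - (s + g s) ≤ _
      push_cast
      calc (t : ℝ) + g t - (s + g s) ≤ (t - s) + 2 * (((t : ℝ) - s) / r) := by linarith
        _ = _ := by ring
    intro s hs t ht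
    rcases le_total s t with h | h
    · exact key s t hs h
    · rw [dist_comm, dist_comm s]; exact key t s ht h
  · rw [φF]
    change _ ≤ (δ n : ℝ) + g (δ n)
    have h1 : ramp δ n (δ n) ≤ g (δ n) :=
      (summable_ramp δ (δ n).coe_nonneg).le_tsum n fun m _ => ramp_nonneg δ m (δ n).coe_nonneg
    have h2 : ramp δ n (δ n) = (1 / 2) ^ n := by
      have : (δ n : ℝ) ≠ 0 := by exact_mod_cast (hδ n).ne'
      simp [ramp, div_self this]
    linarith [(δ n).coe_nonneg]

/-! ### Packings of the unit sphere -/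

/-- The difference of the squares is `(s - t)² + 2(st - 1)(1 - ⟨a,b⟩)`. -/
theorem dist_le_dist_smul_smul {E : Type*} [NormedAddCommGroup E] [InnerProductSpace ℝ E]
    {a b : E} (ha : ‖a‖ = 1) (hb : ‖b‖ = 1) {s t : ℝ} (hs : 1 ≤ s) (ht : 1 ≤ t) :
    dist a b ≤ dist (s • a) (t • b) := by
  rw [dist_eq_norm, dist_eq_norm]
  refine le_of_sq_le_sq ?_ (norm_nonneg _) 
  rw [norm_sub_sq_real, norm_sub_sq_real, norm_smul, norm_smul, ha, hb, inner_smul_left,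
    inner_smul_right, Real.norm_of_nonneg (by linarith), Real.norm_of_nonneg (by linarith)]
  have h : inner ℝ a b ≤ 1 := by simpa [ha, hb] using real_inner_le_norm a b
  simp only [RCLike.conj_to_real]
  nlinarith [sq_nonneg (s - t), mul_nonneg (sub_nonneg.2 h)
    (by nlinarith : 0 ≤ s * t - 1)]

/-- A packing bound: disjoint balls in space contained in a ball. -/
theorem sum_cube_le {ι : Type*} (I : Finset ι) (c : ι → Space) (r : ι → ℝ) (c₀ : Space) {R : ℝ}
    (hR : 0 ≤ R) (hr : ∀ i ∈ I, 0 ≤ r i)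
    (hdisj : ∀ i ∈ I, ∀ j ∈ I, i ≠ j → r i + r j ≤ dist (c i) (c j))
    (hsub : ∀ i ∈ I, dist (c i) c₀ + r i ≤ R) : ∑ i ∈ I, r i ^ 3 ≤ R ^ 3 := by
  have h1 : ∑ i ∈ I, volume (Metric.ball (c i) (r i)) ≤ volume (Metric.ball c₀ R) := by
    rw [← measure_biUnion_finset]
    · refine measure_mono (iUnion₂_subset fun i hi => ?_)
      exact Metric.ball_subset_ball' (by linarith [hsub i hi])
    · intro i hi j hj hij
      exact Metric.ball_disjoint_ball (hdisj i hi j hj hij)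
    · exact fun i _ => measurableSet_ball
  have hV0 : volume (Metric.ball (0 : Space) 1) ≠ 0 :=
    (Metric.measure_ball_pos volume _ one_pos).ne'
  have hVt : volume (Metric.ball (0 : Space) 1) ≠ ⊤ := measure_ball_lt_top.ne
  rw [Measure.addHaar_ball _ _ hR, Finset.sum_congr rfl fun i hi =>
    Measure.addHaar_ball volume (c i) (hr i hi), ← Finset.sum_mul,
    ENNReal.mul_le_mul_iff_left hV0 hVt] at h1
  simp only [finrank_euclideanSpace, Fintype.card_fin] at h1
  rw [← ENNReal.ofReal_sum_of_nonneg fun i hi => pow_nonneg (hr i hi) 3] at h1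
  exact (ENNReal.ofReal_le_ofReal_iff (pow_nonneg hR 3)).1 h1

/-- Separated points of the unit sphere satisfy a two-dimensional packing bound. -/
theorem sum_sq_le_of_separated {ι : Type*} (I : Finset ι) (c : ι → Space) (r : ι → ℝ)
    (c₀ : Space) {R : ℝ} (hc : ∀ i ∈ I, ‖c i‖ = 1) (hr : ∀ i ∈ I, 0 < r i)
    (hrR : ∀ i ∈ I, r i ≤ R) (hsep : ∀ i ∈ I, ∀ j ∈ I, i ≠ j → r i ≤ dist (c i) (c j))
    (hsub : ∀ i ∈ I, dist (c i) c₀ ≤ R) : ∑ i ∈ I, r i ^ 2 ≤ 216 * R ^ 2 := by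
  rcases I.eq_empty_or_nonempty with rfl | ⟨i₀, hi₀⟩
  · simp; positivity
  have hR : 0 < R := (hr i₀ hi₀).trans_le (hrR i₀ hi₀)
  -- Over each point `c i`, about `R / r i` balls of radius `r i / 2` are stacked along the outward
  -- ray. This trades one power of `r i` for `R`, turning the volume bound into an area bound; the
  -- stacks lie in a ball of radius `3R`, and `216 = 8 · 27`.
  have h := sum_cube_le (I.sigma fun i => Finset.range ⌈R / r i⌉₊)
    (fun x => (1 + x.2 * r x.1) • c x.1) (fun x => r x.1 / 2) c₀ (R := 3 * R) (by positivity)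
    ?_ ?_ ?_
  · rw [Finset.sum_sigma] at h
    have h2 : ∑ i ∈ I, R * r i ^ 2 / 8 ≤ (3 * R) ^ 3 := by
      refine le_trans (Finset.sum_le_sum fun i hi => ?_) h
      have h3 : R ≤ ⌈R / r i⌉₊ * r i := (div_le_iff₀ (hr i hi)).1 (Nat.le_ceil _)
      simp only [Finset.sum_const, Finset.card_range, nsmul_eq_mul]
      nlinarith [mul_le_mul_of_nonneg_right h3 (sq_nonneg (r i))]
    rw [← Finset.sum_div, ← Finset.mul_sum] at h2
    have h4 : R * ∑ i ∈ I, r i ^ 2 ≤ R * (216 * R ^ 2) := by nlinarith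
    exact le_of_mul_le_mul_left h4 hR
  · intro x hx
    rw [Finset.mem_sigma] at hx
    exact (half_pos (hr _ hx.1)).le
  · rintro ⟨i, k⟩ hx ⟨j, l⟩ hy hxy
    rw [Finset.mem_sigma] at hx hy
    have hi := hr i hx.1
    have hj := hr j hy.1
    dsimp only
    by_cases hij : i = j
    · subst hij
      have hkl : k ≠ l := fun h => hxy (by rw [h])
      rw [dist_eq_norm, ← sub_smul, norm_smul, hc i hx.1, mul_one,
        show (1 + k * r i) - (1 + l * r i) = ((k : ℝ) - l) * r i by ring, norm_mul,
        Real.norm_of_nonneg hi.le]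
      have h1 : (1 : ℝ) ≤ ‖(k : ℝ) - l‖ := by
        have : (1 : ℤ) ≤ |(k : ℤ) - l| := Int.one_le_abs (by omega)
        rw [Real.norm_eq_abs]
        exact_mod_cast this
      nlinarith
    · have h1 := hsep i hx.1 j hy.1 hij
      have h2 := hsep j hy.1 i hx.1 (Ne.symm hij)
      rw [dist_comm] at h2
      have h3 := dist_le_dist_smul_smul (hc i hx.1) (hc j hy.1)
        (s := 1 + k * r i) (t := 1 + l * r j)
        (by have := mul_nonneg k.cast_nonneg hi.le; linarith)
        (by have := mul_nonneg l.cast_nonneg hj.le; linarith)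
      linarith
  · rintro ⟨i, k⟩ hx
    rw [Finset.mem_sigma, Finset.mem_range] at hx
    have hi := hr i hx.1
    have hk : k * r i ≤ R := ((lt_div_iff₀ hi).1 (Nat.lt_ceil.1 hx.2)).le
    dsimp only
    have h1 : dist ((1 + k * r i) • c i) (c i) = k * r i := by
      rw [dist_eq_norm, add_smul, one_smul, add_sub_cancel_left, norm_smul, hc i hx.1, mul_one,
        Real.norm_of_nonneg (by positivity)]
    have h2 := dist_triangle ((1 + k * r i) • c i) (c i) c₀
    linarith [hsub i hx.1, hrR i hx.1]

/-! ### Coordinates on the surface -/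

/-- The horizontal part of a point of space. -/
def horiz (w : Space) : Plane := !₂[w 0, w 1]

/-- The point of space with horizontal part `x` and height `z`. -/
def pt (x : Plane) (z : ℝ) : Space := !₂[x 0, x 1, z]

theorem continuous_horiz : Continuous horiz := by
  unfold horiz
  refine (PiLp.continuous_toLp 2 _).comp (continuous_pi fun i => ?_)
  fin_cases i <;> simp <;> fun_prop

theorem horiz_pt (x : Plane) (z : ℝ) : horiz (pt x z) = x := by
  ext i; fin_cases i <;> rfl

theorem pt_apply_two (x : Plane) (z : ℝ) : pt x z 2 = z := rfl

theorem dist_sq_eq (a b : Space) :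
    dist a b ^ 2 = dist (horiz a) (horiz b) ^ 2 + (a 2 - b 2) ^ 2 := by
  rw [EuclideanSpace.dist_eq, EuclideanSpace.dist_eq, Real.sq_sqrt (by positivity),
    Real.sq_sqrt (by positivity), Fin.sum_univ_three, Fin.sum_univ_two]
  simp only [horiz, Real.dist_eq, sq_abs]
  rfl

theorem dist_horiz_le (a b : Space) : dist (horiz a) (horiz b) ≤ dist a b :=
  le_of_sq_le_sq (by rw [dist_sq_eq]; linarith [sq_nonneg (a 2 - b 2)]) dist_nonneg

theorem abs_height_sub_le (a b : Space) : |a 2 - b 2| ≤ dist a b :=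
  le_of_sq_le_sq (by rw [sq_abs, dist_sq_eq]; linarith [sq_nonneg (dist (horiz a) (horiz b))])
    dist_nonneg

theorem dist_le_add (a b : Space) : dist a b ≤ dist (horiz a) (horiz b) + |a 2 - b 2| := by
  refine le_of_sq_le_sq ?_ (by positivity)
  rw [dist_sq_eq, add_sq, sq_abs]
  have : 0 ≤ 2 * dist (horiz a) (horiz b) * |a 2 - b 2| := by positivity
  linarith

theorem pt_mem_surface {Ω : Set Plane} {φ : ℝ≥0 ≃ₜ ℝ≥0} {x : Plane} (hx : x ∈ closure Ω) :
    pt x (φ (Metric.infNndist x (frontier Ω))) ∈ surface Ω φ :=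
  ⟨x, hx, rfl, rfl, Or.inl rfl⟩

theorem abs_height_of_mem_surface {Ω : Set Plane} {φ : ℝ≥0 ≃ₜ ℝ≥0} {w : Space}
    (hw : w ∈ surface Ω φ) : |w 2| = φ (Metric.infNndist (horiz w) (frontier Ω)) := by
  obtain ⟨x, -, h0, h1, h2⟩ := hw
  have : horiz w = x := by
    ext i; fin_cases i
    · exact h0
    · exact h1
  rw [this]
  rcases h2 with h2 | h2 <;> simp [h2]

theorem pt_mem_surface_of_mem_frontier {Ω : Set Plane} {φ : ℝ≥0 ≃ₜ ℝ≥0} (h0 : φ 0 = 0)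
    {x : Plane} (hx : x ∈ frontier Ω) : pt x 0 ∈ surface Ω φ := by
  have h := pt_mem_surface (φ := φ) (frontier_subset_closure hx)
  have h1 : Metric.infNndist x (frontier Ω) = 0 := by
    apply NNReal.eq
    rw [Metric.coe_infNndist, Metric.infDist_zero_of_mem hx, NNReal.coe_zero]
  rwa [h1, h0, NNReal.coe_zero] at h

/-! ### Failure of bounded turning -/

/-- For `|a - b| < 1` the segment misses the origin and is projected radially; the projection moves
`v` by `|‖v‖ - 1| ≤ |v - a|`, whence the factor 2. Otherwise the whole sphere serves, as its
diameter is 2. -/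
theorem exists_connected_sphere {a b : Space} (ha : ‖a‖ = 1) (hb : ‖b‖ = 1) :
    ∃ E ⊆ Metric.sphere (0 : Space) 1, IsPreconnected E ∧ a ∈ E ∧ b ∈ E ∧
      ∀ w ∈ E, dist a w ≤ 2 * dist a b := by
  rcases lt_or_ge (dist a b) 1 with h | h
  · have hseg : ∀ v ∈ segment ℝ a b, ‖v - a‖ ≤ dist a b := by
      intro v hv
      have := (convex_closedBall a (dist a b)).segment_subset (Metric.mem_closedBall_self
        dist_nonneg) (by rw [Metric.mem_closedBall, dist_comm]) hv
      rwa [Metric.mem_closedBall, dist_eq_norm] at this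
    have hne : ∀ v ∈ segment ℝ a b, v ≠ 0 := by
      rintro v hv rfl
      have := hseg 0 hv
      rw [zero_sub, norm_neg, ha] at this
      linarith
    refine ⟨(fun v => ‖v‖⁻¹ • v) '' segment ℝ a b, ?_, ?_, ?_, ?_, ?_⟩
    · rintro _ ⟨v, hv, rfl⟩
      simp [norm_smul, inv_mul_cancel₀ (norm_ne_zero_iff.2 (hne v hv))]
    · refine (convex_segment a b).isPreconnected.image _ ?_
      exact ContinuousOn.smul (continuous_norm.continuousOn.inv₀ fun v hv =>
        norm_ne_zero_iff.2 (hne v hv)) continuousOn_id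
    · exact ⟨a, left_mem_segment ℝ a b, by simp [ha]⟩
    · exact ⟨b, right_mem_segment ℝ a b, by simp [hb]⟩
    · rintro _ ⟨v, hv, rfl⟩
      have h1 := hseg v hv
      have h2 : dist v (‖v‖⁻¹ • v) = |‖v‖ - 1| := by
        have hv0 := norm_ne_zero_iff.2 (hne v hv)
        rw [dist_eq_norm, show v - ‖v‖⁻¹ • v = (1 - ‖v‖⁻¹) • v by rw [sub_smul, one_smul],
          norm_smul, Real.norm_eq_abs]
        rw [← abs_of_nonneg (norm_nonneg v), ← abs_mul, abs_of_nonneg (norm_nonneg v), sub_mul,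
          inv_mul_cancel₀ hv0, one_mul]
      have h3 : |‖v‖ - 1| ≤ ‖v - a‖ := by
        have := abs_norm_sub_norm_le v a
        rwa [ha] at this
      have h4 := dist_triangle a v (‖v‖⁻¹ • v)
      rw [dist_comm a v, dist_eq_norm v a] at h4
      dsimp only
      linarith
  · refine ⟨Metric.sphere 0 1, subset_rfl, isPreconnected_sphere ?_ 0 1, by simpa, by simpa, ?_⟩
    · rw [← Module.finrank_eq_rank]; simp
    · intro w hw
      have h1 := dist_triangle_right a w 0
      rw [dist_zero_right, ha, Metric.mem_sphere.1 hw] at h1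
      linarith

/-- A metric space quasisymmetric to the sphere is linearly connected. -/
theorem exists_connected_of_quasisymmetric {X : Type*} [MetricSpace X]
    (h : X ≃ₜ Metric.sphere (0 : Space) 1) {η : ℝ≥0 → ℝ≥0}
    (hη : ∀ (x a b : X) (t : ℝ≥0), 0 < t → dist x a ≤ t * dist x b →
      dist (h x) (h a) ≤ η t * dist (h x) (h b))
    {t : ℝ≥0} (ht : 0 < t) (ht2 : η t < 1 / 2) {x y : X} (hxy : x ≠ y) :
    ∃ E : Set X, IsPreconnected E ∧ x ∈ E ∧ y ∈ E ∧ ∀ w ∈ E, t * dist x w < dist x y := by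
  obtain ⟨E, hE, hc, hx, hy, hd⟩ := exists_connected_sphere (a := h x) (b := h y)
    (by simp) (by simp)
  refine ⟨h.symm '' (Subtype.val ⁻¹' E), ?_, ⟨h x, hx, by simp⟩, ⟨h y, hy, by simp⟩, ?_⟩
  · refine IsPreconnected.image ?_ _ h.symm.continuous.continuousOn
    rw [← Topology.IsInducing.subtypeVal.isPreconnected_image, Subtype.image_preimage_coe,
      inter_eq_right.2 hE]
    exact hc
  · rintro _ ⟨w, hw, rfl⟩
    by_contra! hcon
    -- A point `w` too far away would give `|h x - h y| ≤ η(t)|h x - w| ≤ 2η(t)|h x - h y| < |h x -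
    -- h y|`.
    have h1 := hη x y (h.symm w) t ht hcon
    rw [h.apply_symm_apply] at h1
    have h2 : dist (h x) w ≤ 2 * dist (h x) (h y) := hd w hw
    have h3 : 0 < dist (h x) (h y) := dist_pos.2 (h.injective.ne hxy)
    have h4 : (η t : ℝ) < 1 / 2 := by exact_mod_cast ht2
    nlinarith [(η t).coe_nonneg]

/-- A connected set near `Γ` cannot jump from one piece of `Γ` to another one. -/
theorem exists_delta_of_separated {Γ K₁ K₂ : Set Plane} {x y : Plane} {R : ℝ} (hR : 0 < R)
    (h₁ : IsCompact K₁) (h₂ : IsCompact K₂) (hΓ : Γ ⊆ K₁ ∪ K₂) (hx₁ : x ∈ K₁) (hxΓ : x ∈ Γ)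
    (hy₂ : y ∈ K₂) (hdisj : ∀ w ∈ K₁, w ∈ K₂ → 2 * R < dist x w) :
    ∃ δ : ℝ≥0, 0 < δ ∧ ∀ E : Set Plane, IsPreconnected E → x ∈ E → y ∈ E →
      E ⊆ Metric.closedBall x R → ∃ w ∈ E, δ < Metric.infDist w Γ := by
  -- Inside `B` the two pieces are disjoint compact sets, so they have disjoint thickenings. The
  -- radius `2R` leaves room for points of `Γ` within `R` of a point of `E`.
  set B := Metric.closedBall x (2 * R)
  have hB : IsCompact B := isCompact_closedBall x _
  have hd : Disjoint (K₁ ∩ B) (K₂ ∩ B) := by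
    rw [Set.disjoint_left]
    rintro w ⟨hw1, hwB⟩ ⟨hw2, -⟩
    have := hdisj w hw1 hw2
    rw [Metric.mem_closedBall, dist_comm] at hwB
    linarith
  obtain ⟨ε, hε, hcd⟩ := hd.exists_cthickenings (h₁.inter hB) (h₂.inter hB).isClosed
  refine ⟨⟨min ε R / 2, by positivity⟩, half_pos (lt_min hε hR), ?_⟩
  intro E hE hx hy hER
  by_contra! hcon
  have hxy : dist y x ≤ R := hER hy
  have hsub : E ⊆ Metric.cthickening ε (K₁ ∩ B) ∪ Metric.cthickening ε (K₂ ∩ B) := by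
    intro w hw
    have h1 : Metric.infDist w Γ < min ε R :=
      lt_of_le_of_lt (hcon w hw) (half_lt_self (lt_min hε hR))
    obtain ⟨q, hq, hwq⟩ := (Metric.infDist_lt_iff ⟨x, hxΓ⟩).1 h1
    have hwx : dist w x ≤ R := hER hw
    have hqB : q ∈ B := by
      rw [Metric.mem_closedBall]
      have := dist_triangle_left q x w
      linarith [min_le_right ε R]
    have hle : dist w q ≤ ε := hwq.le.trans (min_le_left _ _)
    rcases hΓ hq with hq | hq
    · exact Or.inl (Metric.mem_cthickening_of_dist_le w q ε _ ⟨hq, hqB⟩ hle)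
    · exact Or.inr (Metric.mem_cthickening_of_dist_le w q ε _ ⟨hq, hqB⟩ hle)
  obtain ⟨w, -, hw1, hw2⟩ := isPreconnected_closed_iff.1 hE _ _ Metric.isClosed_cthickening
    Metric.isClosed_cthickening hsub
    ⟨x, hx, Metric.self_subset_cthickening _ ⟨hx₁, Metric.mem_closedBall_self (by positivity)⟩⟩
    ⟨y, hy, Metric.self_subset_cthickening _ ⟨hy₂, hxy.trans (by linarith)⟩⟩
  exact Set.disjoint_left.1 hcd hw1 hw2

/-- If the two arcs of `Γ` between `x` and `y` leave a large ball about `x`, then a surface that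
is steep enough at the corresponding scale is not linearly connected. -/
theorem exists_delta_turning {Ω K₁ K₂ : Set Plane} {x y : Plane} {n : ℕ}
    (h₁ : IsCompact K₁) (h₂ : IsCompact K₂) (hΓ : frontier Ω ⊆ K₁ ∪ K₂) (hx₁ : x ∈ K₁)
    (hx : x ∈ frontier Ω) (hy : y ∈ frontier Ω) (hxy : x ≠ y) (hn : 0 < n)
    (hy₂ : y ∈ K₂) (hdisj : ∀ w ∈ K₁, w ∈ K₂ → 2 * (n * dist x y) < dist x w)
    (hle : n * dist x y ≤ (1 / 2) ^ n) :
    ∃ δ : ℝ≥0, 0 < δ ∧ ∀ φ : ℝ≥0 ≃ₜ ℝ≥0, φ 0 = 0 → StrictMono φ → (1 / 2 : ℝ) ^ n ≤ φ δ →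
      ∀ (h : surface Ω φ ≃ₜ Metric.sphere (0 : Space) 1) (η : ℝ≥0 → ℝ≥0),
      (∀ (x a b : surface Ω φ) (t : ℝ≥0), 0 < t → dist x a ≤ t * dist x b →
        dist (h x) (h a) ≤ η t * dist (h x) (h b)) →
      ∀ t : ℝ≥0, 0 < t → η t < 1 / 2 → n * t < 1 := by
  have hn' : (0 : ℝ) < n := Nat.cast_pos.2 hn
  obtain ⟨δ, hδ, H⟩ := exists_delta_of_separated (mul_pos hn' (dist_pos.2 hxy)) h₁ h₂ hΓ hx₁ hx
    hy₂ hdisj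
  refine ⟨δ, hδ, fun φ h0 hmono hφ h η hη t ht ht2 => ?_⟩
  by_contra! hcon
  have hcon' : (1 : ℝ) ≤ n * t := by exact_mod_cast hcon
  let X : surface Ω φ := ⟨pt x 0, pt_mem_surface_of_mem_frontier h0 hx⟩
  let Y : surface Ω φ := ⟨pt y 0, pt_mem_surface_of_mem_frontier h0 hy⟩
  have hdXY : dist X Y ≤ dist x y := by
    have := dist_le_add (pt x 0) (pt y 0)
    rw [horiz_pt, horiz_pt, pt_apply_two, pt_apply_two, sub_zero, abs_zero, add_zero] at this
    exact this
  have hXY : X ≠ Y := fun hh => hxy <| by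
    have := congrArg (fun w : surface Ω φ => horiz w) hh
    simpa [X, Y, horiz_pt] using this
  obtain ⟨E, hEc, hEX, hEY, hE⟩ := exists_connected_of_quasisymmetric h hη ht ht2 hXY
  have hE' : ∀ w ∈ E, dist (w : Space) (pt x 0) ≤ n * dist x y := by
    intro w hw
    have h1 := (hE w hw).le.trans hdXY
    have h2 : dist X w = dist (w : Space) (pt x 0) := dist_comm _ _
    rw [h2] at h1
    calc dist (w : Space) (pt x 0) ≤ n * t * dist (w : Space) (pt x 0) :=
          le_mul_of_one_le_left dist_nonneg hcon'
      _ = n * (t * dist (w : Space) (pt x 0)) := by ring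
      _ ≤ _ := by gcongr
  obtain ⟨_, ⟨w, hw, rfl⟩, hwδ⟩ := H ((fun w : surface Ω φ => horiz w) '' E)
    (hEc.image _ (continuous_horiz.comp continuous_subtype_val).continuousOn)
    ⟨X, hEX, horiz_pt x 0⟩ ⟨Y, hEY, horiz_pt y 0⟩ (by
      rintro _ ⟨w, hw, rfl⟩
      have := dist_horiz_le w (pt x 0)
      rw [horiz_pt] at this
      exact this.trans (hE' w hw))
  -- The height of `w` is at most `n|x - y| ≤ 2⁻ⁿ ≤ φ δ`, while its depth exceeds `δ`.
  have h1 := abs_height_sub_le w (pt x 0)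
  rw [pt_apply_two, sub_zero, abs_height_of_mem_surface w.2] at h1
  have h2 : φ (Metric.infNndist (horiz w) (frontier Ω)) ≤ φ δ := by
    exact_mod_cast (h1.trans (hE' w hw)).trans (hle.trans hφ)
  have h3 := hmono.le_iff_le.1 h2
  rw [← Metric.coe_infNndist] at hwδ
  exact absurd h3 (not_le.2 (by exact_mod_cast hwδ))

/-! ### Large packings of the boundary -/

/-- Close to any boundary point there are points of the closure at every small depth. -/
theorem exists_mem_closure_infNndist_eq {Ω : Set Plane} {p : Plane} (hp : p ∈ frontier Ω)
    (hΩ : IsOpen Ω) {ε : ℝ} (hε : 0 < ε) :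
    ∃ τ : ℝ≥0, 0 < τ ∧ ∀ t ≤ τ, ∃ x ∈ closure Ω, dist x p ≤ ε ∧
      Metric.infNndist x (frontier Ω) = t := by
  obtain ⟨q, hq, hpq⟩ := Metric.mem_closure_iff.1 (frontier_subset_closure hp) (ε / 2)
    (half_pos hε)
  have hqF : q ∉ frontier Ω := fun h => (hΩ.frontier_eq ▸ h).2 hq
  -- On the segment from the nearest boundary point `y` to `q` the depth takes all values between 0
  -- and that of `q`. The segment stays in the closure, since leaving it would meet the boundary
  -- closer to `q` than `y`.
  obtain ⟨y, hy, hqy⟩ := isClosed_frontier.exists_infDist_eq_dist ⟨p, hp⟩ q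
  have hmin : ∀ z ∈ frontier Ω, dist q y ≤ dist q z := fun z hz =>
    hqy ▸ Metric.infDist_le_dist_of_mem hz
  have hτ : 0 < Metric.infNndist q (frontier Ω) := by
    rw [← NNReal.coe_pos, Metric.coe_infNndist]
    exact (isClosed_frontier.notMem_iff_infDist_pos ⟨p, hp⟩).1 hqF
  refine ⟨_, hτ, fun t ht => ?_⟩
  have hy0 : Metric.infNndist y (frontier Ω) = 0 := by
    apply NNReal.eq
    rw [Metric.coe_infNndist, Metric.infDist_zero_of_mem hy, NNReal.coe_zero]
  obtain ⟨x, hx, hxt⟩ := (convex_segment y q).isPreconnected.intermediate_value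
    (left_mem_segment ℝ y q) (right_mem_segment ℝ y q)
    (Metric.continuous_infNndist_pt (frontier Ω)).continuousOn ⟨by rw [hy0]; exact zero_le, ht⟩
  rw [segment_symm] at hx
  have hqx : dist q x + dist x y = dist q y := dist_add_dist_of_mem_segment hx
  refine ⟨x, ?_, ?_, hxt⟩
  · by_contra hxc
    have hseg : (segment ℝ q x ∩ frontier Ω).Nonempty := by
      by_contra hcon
      obtain ⟨z, -, hz1, hz2⟩ := (convex_segment q x).isPreconnected Ω (closure Ω)ᶜ hΩ
        isClosed_closure.isOpen_compl (fun z hz => by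
          by_contra hz'
          rw [mem_union, not_or, notMem_compl_iff] at hz'
          exact hcon ⟨z, hz, hΩ.frontier_eq ▸ ⟨hz'.2, hz'.1⟩⟩)
        ⟨q, left_mem_segment ℝ q x, hq⟩ ⟨x, right_mem_segment ℝ q x, hxc⟩
      exact hz2 (subset_closure hz1)
    obtain ⟨z, hz, hzF⟩ := hseg
    have h1 : dist q z + dist z x = dist q x := dist_add_dist_of_mem_segment hz
    have h2 : dist x y = 0 := by
      have := hmin z hzF
      linarith [dist_nonneg (x := z) (y := x), dist_nonneg (x := x) (y := y)]
    rw [dist_eq_zero.1 h2] at hxc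
    exact hxc (frontier_subset_closure hy)
  · have h1 := hmin p hp
    have h2 := dist_triangle_left x p q
    rw [dist_comm] at hpq
    linarith [dist_nonneg (x := x) (y := y)]

/-- The length-area estimate: many columns of separated chains in the unit sphere. -/
theorem card_le_of_columns {ι : Type*} (I : Finset ι) (n : ℕ) (v : ι → ℕ → Space) {E : ℝ}
    (hE : 1 ≤ E) (hv : ∀ i ∈ I, ∀ j, j ≤ n → ‖v i j‖ = 1)
    (hpos : ∀ i ∈ I, ∀ j, j < n → v i j ≠ v i (j + 1))
    (hpos' : ∀ i ∈ I, v i 0 ≠ v i n)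
    (hsep : ∀ i ∈ I, ∀ k ∈ I, ∀ j l, j < n → l < n → (i ≠ k ∨ j ≠ l) →
      dist (v i j) (v i (j + 1)) ≤ E * dist (v i j) (v k l))
    (hdiam : ∀ i ∈ I, ∀ k ∈ I, ∀ j ≤ n, dist (v i 0) (v k j) ≤ E * dist (v i 0) (v i n)) :
    (I.card : ℝ) ≤ 3456 * E ^ 6 * n := by
  rcases I.eq_empty_or_nonempty with rfl | ⟨o, ho⟩
  · simp; positivity
  have hE0 : 0 < E := by linarith
  set D : ι → ℝ := fun i => dist (v i 0) (v i n) with hD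
  have hDo : 0 < D o := dist_pos.2 (hpos' o ho)
  -- By `hsep`, radii equal to the vertical steps divided by `E` are admissible for the packing; by
  -- `hdiam`, all points lie within `2E · D o` of `v o 0`.
  have hpack := sum_sq_le_of_separated (I ×ˢ Finset.range n) (fun x => v x.1 x.2)
    (fun x => dist (v x.1 x.2) (v x.1 (x.2 + 1)) / E) (v o 0) (R := 2 * E * D o)
    ?_ ?_ ?_ ?_ ?_
  · rw [Finset.sum_product] at hpack
    -- Cauchy–Schwarz along one column: its end-to-end distance, comparable to `D o`, is at most the
    -- sum of its `n` steps.
    have hcol : ∀ i ∈ I, D o ^ 2 ≤ 4 * E ^ 4 * n *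
        ∑ j ∈ Finset.range n, (dist (v i j) (v i (j + 1)) / E) ^ 2 := by
      intro i hi
      have h1 : D i ≤ ∑ j ∈ Finset.range n, dist (v i j) (v i (j + 1)) :=
        dist_le_range_sum_dist (v i) n
      have h2 := sq_sum_le_card_mul_sum_sq (s := Finset.range n)
        (f := fun j => dist (v i j) (v i (j + 1)))
      rw [Finset.card_range] at h2
      have h3 : D o ≤ 2 * E * D i := by
        have ha := hdiam i hi o ho 0 (Nat.zero_le _)
        have hb := hdiam i hi o ho n le_rfl
        have hc := dist_triangle_left (v o 0) (v o n) (v i 0)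
        simp only [hD]
        linarith
      have h4 : D i ^ 2 ≤ n * ∑ j ∈ Finset.range n, dist (v i j) (v i (j + 1)) ^ 2 :=
        (pow_le_pow_left₀ dist_nonneg h1 2).trans h2
      simp only [div_pow]
      rw [← Finset.sum_div]
      calc D o ^ 2 ≤ (2 * E * D i) ^ 2 := pow_le_pow_left₀ hDo.le h3 2
        _ = 4 * E ^ 2 * D i ^ 2 := by ring
        _ ≤ 4 * E ^ 2 * (n * ∑ j ∈ Finset.range n, dist (v i j) (v i (j + 1)) ^ 2) := by gcongr
        _ = _ := by field_simp
    have h5 := Finset.sum_le_sum hcol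
    rw [Finset.sum_const, nsmul_eq_mul, ← Finset.mul_sum] at h5
    have h6 : (I.card : ℝ) * D o ^ 2 ≤ (3456 * E ^ 6 * n) * D o ^ 2 :=
      calc (I.card : ℝ) * D o ^ 2 ≤ 4 * E ^ 4 * n * (216 * (2 * E * D o) ^ 2) :=
            h5.trans (by gcongr)
        _ = _ := by ring
    exact le_of_mul_le_mul_right h6 (by positivity)
  all_goals simp only [Finset.mem_product, Finset.mem_range]
  · exact fun x hx => hv _ hx.1 _ hx.2.le
  · exact fun x hx => div_pos (dist_pos.2 (hpos _ hx.1 _ hx.2)) hE0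
  · intro x hx
    have ha := hdiam o ho x.1 hx.1 x.2 hx.2.le
    have hb := hdiam o ho x.1 hx.1 (x.2 + 1) hx.2
    have hc := dist_triangle_left (v x.1 x.2) (v x.1 (x.2 + 1)) (v o 0)
    exact (div_le_self dist_nonneg hE).trans (by simp only [hD]; linarith)
  · intro x hx y hy hxy
    rw [div_le_iff₀' hE0]
    refine hsep _ hx.1 _ hy.1 _ _ hx.2 hy.2 ?_
    by_contra! hcon
    exact hxy (Prod.ext hcon.1 hcon.2)
  · intro x hx
    have ha := hdiam o ho x.1 hx.1 x.2 hx.2.le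
    rw [dist_comm] at ha
    have : 0 ≤ E * D o := by positivity
    simp only [hD] at this ⊢
    linarith

/-- A surface that is steep at scale `d` forces, if quasisymmetric to the sphere, a linear bound
for the packings of the boundary by balls of radius `s ≤ d` inside a ball of radius `d`. -/
theorem exists_delta_packing {Ω : Set Plane} (hΩ : IsOpen Ω) {p : Plane} {s d : ℝ} (hs : 0 < s)
    (hsd : s ≤ d) (P : Finset Plane) (hPΩ : ∀ q ∈ P, q ∈ frontier Ω)
    (hPd : ∀ q ∈ P, dist q p ≤ d) (hPs : ∀ q ∈ P, ∀ q' ∈ P, q ≠ q' → s ≤ dist q q') :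
    ∃ δ : ℝ≥0, 0 < δ ∧ ∀ φ : ℝ≥0 ≃ₜ ℝ≥0, StrictMono φ → d ≤ φ δ →
      ∀ (h : surface Ω φ ≃ₜ Metric.sphere (0 : Space) 1) (η : ℝ≥0 → ℝ≥0),
      (∀ (x a b : surface Ω φ) (t : ℝ≥0), 0 < t → dist x a ≤ t * dist x b →
        dist (h x) (h a) ≤ η t * dist (h x) (h b)) →
      ∀ E : ℝ, 1 ≤ E → η 4 ≤ E → η 8 ≤ E → P.card * s ≤ 3456 * E ^ 6 * d := by
  have hd : 0 < d := hs.trans_le hsd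
  have hτ : ∀ q : Plane, ∃ τ : ℝ≥0, 0 < τ ∧ (q ∈ frontier Ω → ∀ t ≤ τ, ∃ x ∈ closure Ω,
      dist x q ≤ s / 8 ∧ Metric.infNndist x (frontier Ω) = t) := by
    intro q
    by_cases hq : q ∈ frontier Ω
    · obtain ⟨τ, h0, h1⟩ := exists_mem_closure_infNndist_eq hq hΩ (ε := s / 8) (by positivity)
      exact ⟨τ, h0, fun _ => h1⟩
    · exact ⟨1, one_pos, fun h => absurd h hq⟩
  choose τ hτ0 hτ using hτ
  have hδ : ∀ᶠ δ : ℝ≥0 in 𝓝[>] 0, ∀ q ∈ P, δ ≤ τ q := by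
    refine (Finset.eventually_all P).2 fun q _ => ?_
    filter_upwards [Ioo_mem_nhdsGT (hτ0 q)] with δ hδ using hδ.2.le
  obtain ⟨δ, hδ, hδ0⟩ := (hδ.and self_mem_nhdsWithin).exists
  refine ⟨δ, hδ0, fun φ hmono hφ h η hη E hE hη4 hη8 => ?_⟩
  rcases P.eq_empty_or_nonempty with rfl | ⟨o, ho⟩
  · simp; positivity
  set n := ⌊d / s⌋₊
  have hns : n * s ≤ d := (le_div_iff₀ hs).1 (Nat.floor_le (by positivity))
  have hn1 : 1 ≤ n := Nat.le_floor (by rw [Nat.cast_one, le_div_iff₀ hs]; linarith)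
  have hn1' : (1 : ℝ) ≤ n := by exact_mod_cast hn1
  have hnd : d < (n + 1) * s := (div_lt_iff₀ hs).1 (Nat.lt_floor_add_one _)
  -- `V q j` is the grid point of column `q` at height `j s`. Such a point exists within `s / 8` of
  -- `q` horizontally, because steepness puts height `j s ≤ d` at depth at most `δ ≤ τ q`. Steps of
  -- at most `2s` against gaps of at least `s / 2` give the ratio 4 in `η 4`; distances of at most
  -- `4d` against column lengths of at least `d / 2` give the 8 in `η 8`.
  have hV : ∀ (q : Plane) (j : ℕ), ∃ V : surface Ω φ, q ∈ P → j ≤ n →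
      dist (horiz V) q ≤ s / 8 ∧ (V : Space) 2 = j * s := by
    intro q j
    by_cases hqj : q ∈ P ∧ j ≤ n
    · obtain ⟨hq, hj⟩ := hqj
      have hjs : (j : ℝ) * s ≤ φ δ :=
        (mul_le_mul_of_nonneg_right (Nat.cast_le.2 hj) hs.le).trans (hns.trans hφ)
      set z : ℝ≥0 := ⟨j * s, by positivity⟩
      have ht : φ.symm z ≤ δ := by
        rw [← hmono.le_iff_le, φ.apply_symm_apply]
        exact hjs
      obtain ⟨x, hx, hxq, hxt⟩ := hτ q (hPΩ q hq) _ (ht.trans (hδ q hq))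
      refine ⟨⟨_, pt_mem_surface hx⟩, fun _ _ => ⟨by rwa [horiz_pt], ?_⟩⟩
      rw [pt_apply_two, hxt, φ.apply_symm_apply]
      rfl
    · obtain ⟨x, hx, -⟩ := hτ o (hPΩ o ho) 0 zero_le
      exact ⟨⟨_, pt_mem_surface hx⟩, fun h1 h2 => absurd ⟨h1, h2⟩ hqj⟩
  choose V hV using hV
  have hlow : ∀ i ∈ P, ∀ k ∈ P, ∀ j l, j ≤ n → l ≤ n → (i ≠ k ∨ j ≠ l) →
      s / 2 ≤ dist (V i j) (V k l) := by
    intro i hi k hk j l hj hl hne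
    obtain ⟨h1, h2⟩ := hV i j hi hj
    obtain ⟨h3, h4⟩ := hV k l hk hl
    by_cases hik : i = k
    · have hjl : j ≠ l := hne.resolve_left (not_not.2 hik)
      have h5 := abs_height_sub_le (V i j) (V k l)
      rw [h2, h4, ← sub_mul, abs_mul, abs_of_pos hs] at h5
      have h6 : (1 : ℝ) ≤ |(j : ℝ) - l| := by
        have : (1 : ℤ) ≤ |(j : ℤ) - l| := Int.one_le_abs (by omega)
        exact_mod_cast this
      have h7 : dist (V i j) (V k l) = dist (V i j : Space) (V k l) := rfl
      nlinarith
    · have h5 := hPs i hi k hk hik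
      have h6 := dist_triangle4 i (horiz (V i j)) (horiz (V k l)) k
      rw [dist_comm] at h1
      have h7 : dist (V i j) (V k l) = dist (V i j : Space) (V k l) := rfl
      linarith [dist_horiz_le (V i j) (V k l)]
  have hup : ∀ i ∈ P, ∀ j, j < n → dist (V i j) (V i (j + 1)) ≤ 2 * s := by
    intro i hi j hj
    obtain ⟨h1, h2⟩ := hV i j hi hj.le
    obtain ⟨h3, h4⟩ := hV i (j + 1) hi hj
    have h5 := dist_le_add (V i j) (V i (j + 1))
    have h6 := dist_triangle_right (horiz (V i j)) (horiz (V i (j + 1))) i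
    have h8 : |(V i j : Space) 2 - (V i (j + 1) : Space) 2| = s := by
      rw [h2, h4, Nat.cast_add_one, abs_sub_comm, show ((j : ℝ) + 1) * s - j * s = s by ring,
        abs_of_pos hs]
    have h7 : dist (V i j) (V i (j + 1)) = dist (V i j : Space) (V i (j + 1)) := rfl
    linarith
  have hwide : ∀ i ∈ P, ∀ k ∈ P, ∀ j ≤ n, dist (V i 0) (V k j) ≤ 4 * d := by
    intro i hi k hk j hj
    obtain ⟨h1, h2⟩ := hV i 0 hi (Nat.zero_le _)
    obtain ⟨h3, h4⟩ := hV k j hk hj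
    have h5 := dist_le_add (V i 0) (V k j)
    have h6 := dist_triangle4 (horiz (V i 0)) i k (horiz (V k j))
    have h9 := dist_triangle_right i k p
    rw [dist_comm] at h3
    have h8 : |(V i 0 : Space) 2 - (V k j : Space) 2| ≤ d := by
      rw [h2, h4, Nat.cast_zero, zero_mul, zero_sub, abs_neg, abs_of_nonneg (by positivity)]
      exact (mul_le_mul_of_nonneg_right (Nat.cast_le.2 hj) hs.le).trans hns
    have h7 : dist (V i 0) (V k j) = dist (V i 0 : Space) (V k j) := rfl
    linarith [hPd i hi, hPd k hk]
  have htall : ∀ i ∈ P, d / 2 ≤ dist (V i 0) (V i n) := by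
    intro i hi
    have h5 := abs_height_sub_le (V i 0) (V i n)
    rw [(hV i 0 hi (Nat.zero_le _)).2, (hV i n hi le_rfl).2, Nat.cast_zero, zero_mul, zero_sub,
      abs_neg, abs_of_nonneg (by positivity)] at h5
    have h7 : dist (V i 0) (V i n) = dist (V i 0 : Space) (V i n) := rfl
    nlinarith
  have hcard := card_le_of_columns P n (fun i j => (h (V i j) : Space)) hE ?_ ?_ ?_ ?_ ?_
  · calc P.card * s ≤ 3456 * E ^ 6 * n * s := by gcongr
      _ = 3456 * E ^ 6 * (n * s) := by ring
      _ ≤ _ := by gcongr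
  · intro i _ j _
    simp
  · intro i hi j hj heq
    have := hlow i hi i hi j (j + 1) hj.le hj (Or.inr (by omega))
    rw [h.injective (Subtype.ext heq), dist_self] at this
    linarith
  · intro i hi heq
    have := htall i hi
    rw [h.injective (Subtype.ext heq), dist_self] at this
    linarith
  · intro i hi k hk j l hj hl hne
    have h1 := hη (V i j) (V i (j + 1)) (V k l) 4 (by norm_num) (by
      have := hlow i hi k hk j l hj.le hl.le hne
      have := hup i hi j hj
      rw [NNReal.coe_ofNat]
      linarith)
    exact h1.trans (mul_le_mul_of_nonneg_right hη4 dist_nonneg)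
  · intro i hi k hk j hj
    have h1 := hη (V i 0) (V k j) (V i n) 8 (by norm_num) (by
      have := htall i hi
      have := hwide i hi k hk j hj
      rw [NNReal.coe_ofNat]
      linarith)
    exact h1.trans (mul_le_mul_of_nonneg_right hη8 dist_nonneg)

/-! ### Chord-arc curves -/

/-- Below scale `2⁻ⁿ` the set `Γ` has a separated subset that is large compared with `n`. -/
def HasLargePacking (Γ : Set Plane) (n : ℕ) : Prop :=
  ∃ (p : Plane) (s d : ℝ) (P : Finset Plane), 0 < s ∧ s ≤ d ∧ d ≤ (1 / 2) ^ n ∧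
    (∀ q ∈ P, q ∈ Γ) ∧ (∀ q ∈ P, dist q p ≤ d) ∧
    (∀ q ∈ P, ∀ q' ∈ P, q ≠ q' → s ≤ dist q q') ∧ n * d < P.card * s

/-- Below scale `2⁻ⁿ` there are two points of the curve such that both arcs between them have a
diameter that is large compared with `n`. -/
def HasWideArcs (f : ℝ → Plane) (n : ℕ) : Prop :=
  ∃ s t : ℝ, 0 ≤ s ∧ s ≤ t ∧ t ≤ 1 ∧ n * dist (f s) (f t) ≤ (1 / 2) ^ n ∧
    (∃ u ∈ Icc s t, 2 * (n * dist (f s) (f t)) < dist (f s) (f u)) ∧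
    ∃ v ∈ Icc 0 s ∪ Icc t 1, 2 * (n * dist (f s) (f t)) < dist (f s) (f v)

/-- The packing bound limits the size of `s`-separated subsets of `Γ ∩ B(p,d)`; one of largest size
is an `s`-net. -/
theorem exists_finset_cover {Γ : Set Plane} {n : ℕ} (h : ¬ HasLargePacking Γ n) (p : Plane)
    {s d : ℝ} (hs : 0 < s) (hsd : s ≤ d) (hd : d ≤ (1 / 2) ^ n) :
    ∃ P : Finset Plane, P.card * s ≤ n * d ∧
      Γ ∩ Metric.closedBall p d ⊆ ⋃ q : P, Metric.closedBall (q : Plane) s := by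
  classical
  let Q : ℕ → Prop := fun m => ∃ P : Finset Plane, P.card = m ∧ (∀ q ∈ P, q ∈ Γ) ∧
    (∀ q ∈ P, dist q p ≤ d) ∧ ∀ q ∈ P, ∀ q' ∈ P, q ≠ q' → s ≤ dist q q'
  have hbd : ∀ m, Q m → m * s ≤ n * d := by
    rintro m ⟨P, rfl, h1, h2, h3⟩
    by_contra! hcon
    exact h ⟨p, s, d, P, hs, hsd, hd, h1, h2, h3, hcon⟩
  have hbd' : ∀ m, Q m → m ≤ ⌊n * d / s⌋₊ := fun m hm =>
    Nat.le_floor ((le_div_iff₀ hs).2 (hbd m hm))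
  have hQ := Nat.findGreatest_spec (P := Q) (Nat.zero_le ⌊n * d / s⌋₊) ⟨∅, by simp⟩
  have hmax : ∀ k, Q k → k ≤ Nat.findGreatest Q ⌊n * d / s⌋₊ := fun k hk =>
    Nat.le_findGreatest (hbd' k hk) hk
  refine hQ.elim fun P hP => ⟨P, ?_, ?_⟩
  · rw [hP.1]; exact hbd _ hQ
  obtain ⟨hc, h1, h2, h3⟩ := hP
  rintro w ⟨hwΓ, hwd⟩
  by_contra hw
  simp only [mem_iUnion, Metric.mem_closedBall, Subtype.exists, not_exists, not_le] at hw
  have hwP : w ∉ P := fun hh => by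
    have := hw w hh
    rw [dist_self] at this
    linarith
  have := hmax (P.card + 1) ⟨insert w P, Finset.card_insert_of_notMem hwP, ?_, ?_, ?_⟩
  · omega
  · intro q hq
    rcases Finset.mem_insert.1 hq with rfl | hq
    exacts [hwΓ, h1 q hq]
  · intro q hq
    rcases Finset.mem_insert.1 hq with rfl | hq
    exacts [hwd, h2 q hq]
  · intro q hq q' hq' hne
    rcases Finset.mem_insert.1 hq with rfl | h4 <;> rcases Finset.mem_insert.1 hq' with rfl | h5
    · exact absurd rfl hne
    · exact (hw q' h5).le
    · rw [dist_comm]; exact (hw q h4).le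
    · exact h3 q h4 q' h5 hne

/-- At scale `d / (k+1)` at most `n(k+1)` balls cover, with sum of diameters at most `2nd`; then `k
→ ∞`. -/
theorem hausdorffMeasure_le_of_not_hasLargePacking {Γ : Set Plane} {n : ℕ}
    (h : ¬ HasLargePacking Γ n) (p : Plane) {d : ℝ} (hd0 : 0 < d) (hd : d ≤ (1 / 2) ^ n) :
    μH[1] (Γ ∩ Metric.closedBall p d) ≤ ENNReal.ofReal (2 * n * d) := by
  have hk : ∀ k : ℕ, (0 : ℝ) < d / (k + 1) := fun k => by positivity
  have hk' : ∀ k : ℕ, d / (k + 1 : ℝ) ≤ d := fun k => div_le_self hd0.le (by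
    have := k.cast_nonneg (α := ℝ); linarith)
  choose P hP hcov using fun k : ℕ => exists_finset_cover h p (hk k) (hk' k) hd
  have hdiam : ∀ (k : ℕ) (q : P k), Metric.ediam (Metric.closedBall (q : Plane) (d / (k + 1)))
      ≤ ENNReal.ofReal (2 * (d / (k + 1))) := by
    intro k q
    refine Metric.ediam_le fun x hx y hy => ?_
    rw [edist_dist]
    refine ENNReal.ofReal_le_ofReal ((dist_triangle_right x y q).trans ?_)
    rw [Metric.mem_closedBall] at hx hy
    linarith
  have htend : Tendsto (fun k : ℕ => ENNReal.ofReal (2 * (d / (k + 1)))) atTop (𝓝 0) := by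
    rw [← ENNReal.ofReal_zero]
    refine ENNReal.tendsto_ofReal ?_
    have := (tendsto_one_div_add_atTop_nhds_zero_nat (𝕜 := ℝ)).const_mul (2 * d)
    rw [mul_zero] at this
    refine this.congr fun k => by ring
  refine (Measure.hausdorffMeasure_le_liminf_sum 1 _ _ htend
    (fun k (q : P k) => Metric.closedBall (q : Plane) (d / (k + 1)))
    (Eventually.of_forall hdiam) (Eventually.of_forall hcov)).trans ?_
  refine (liminf_le_liminf (Eventually.of_forall fun k => ?_)).trans (liminf_const _).le
  calc ∑ q : P k, Metric.ediam (Metric.closedBall (q : Plane) (d / (k + 1))) ^ (1 : ℝ)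
      ≤ ∑ _q : P k, ENNReal.ofReal (2 * (d / (k + 1))) :=
        Finset.sum_le_sum fun q _ => by rw [ENNReal.rpow_one]; exact hdiam k q
    _ = ENNReal.ofReal ((P k).card * (2 * (d / (k + 1)))) := by
        rw [Finset.sum_const, nsmul_eq_mul, ENNReal.ofReal_mul (Nat.cast_nonneg _),
          ENNReal.ofReal_natCast, Finset.card_univ, Fintype.card_coe]
    _ ≤ _ := ENNReal.ofReal_le_ofReal (by linarith [hP k])

/-- Compactness makes the total measure `m` finite, and for `d > 2⁻ⁿ` it is absorbed by the term `m
/ 2⁻ⁿ` of the constant. -/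
theorem exists_hausdorffMeasure_le {Γ : Set Plane} (hΓ : IsCompact Γ) {n : ℕ}
    (h : ¬ HasLargePacking Γ n) : ∃ M : ℝ, 0 ≤ M ∧ ∀ (p : Plane) (d : ℝ), 0 ≤ d →
      μH[1] (Γ ∩ Metric.closedBall p d) ≤ ENNReal.ofReal (M * d) := by
  have h2 : (0 : ℝ) < (1 / 2) ^ n := by positivity
  have hfin : μH[1] Γ < ⊤ := hΓ.measure_lt_top_of_nhdsWithin fun x _ =>
    ⟨_, inter_mem_nhdsWithin Γ (Metric.closedBall_mem_nhds x h2),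
      (hausdorffMeasure_le_of_not_hasLargePacking h x h2 le_rfl).trans_lt ENNReal.ofReal_lt_top⟩
  set m : ℝ := (μH[1] Γ).toReal with hm
  have hm0 : 0 ≤ m := ENNReal.toReal_nonneg
  refine ⟨2 * n + m / (1 / 2) ^ n, by positivity, fun p d hd => ?_⟩
  rcases hd.eq_or_lt with rfl | hd
  · have := Measure.nullSingletonClass_hausdorff Plane (d := 1) one_pos
    have : μH[1] (Γ ∩ Metric.closedBall p 0) ≤ μH[1] {p} :=
      measure_mono (by rw [Metric.closedBall_zero]; exact inter_subset_right)
    rw [measure_singleton] at this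
    exact this.trans zero_le
  rcases le_or_gt d ((1 / 2) ^ n) with hd' | hd'
  · refine (hausdorffMeasure_le_of_not_hasLargePacking h p hd hd').trans
      (ENNReal.ofReal_le_ofReal ?_)
    gcongr
    linarith [show 0 ≤ m / (1 / 2) ^ n by positivity]
  · calc μH[1] (Γ ∩ Metric.closedBall p d) ≤ μH[1] Γ := measure_mono inter_subset_left
      _ = ENNReal.ofReal m := (ENNReal.ofReal_toReal hfin.ne).symm
      _ ≤ _ := by
        refine ENNReal.ofReal_le_ofReal ?_
        calc m = m / (1 / 2) ^ n * (1 / 2) ^ n := by field_simp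
          _ ≤ (2 * n + m / (1 / 2) ^ n) * d := by
            gcongr
            linarith [n.cast_nonneg (α := ℝ)]

/-- The distance to `f a` is 1-Lipschitz and maps the arc onto a set containing `[0, |f a - f b|]`.
-/
theorem edist_le_hausdorffMeasure_image {f : ℝ → Plane} {a b : ℝ} (hab : a ≤ b)
    (hf : ContinuousOn f (Icc a b)) : edist (f a) (f b) ≤ μH[1] (f '' Icc a b) := by
  have hL : LipschitzWith 1 (fun x => dist x (f a)) := LipschitzWith.dist_left (f a)
  have h1 := hL.hausdorffMeasure_image_le (d := 1) zero_le_one (f '' Icc a b)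
  rw [ENNReal.coe_one, ENNReal.one_rpow, one_mul] at h1
  refine le_trans ?_ h1
  have h2 := intermediate_value_Icc hab (hL.continuous.comp_continuousOn hf)
  rw [hausdorffMeasure_real, ← image_comp]
  refine le_trans ?_ (measure_mono h2)
  rw [Real.volume_Icc, Function.comp_apply, Function.comp_apply, dist_self, sub_zero, dist_comm,
    edist_dist]

/-! ### Arcs of a Jordan curve: intersections, lengths and the chord-arc condition. -/

section JordanParam

variable {f : ℝ → Plane} {γ : Set Plane}

theorem IsJordanParam.eq_of_apply_eq (hf : IsJordanParam f γ) {u v : ℝ} (hu : 0 ≤ u)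
    (huv : u ≤ v) (hv : v ≤ 1) (h : f u = f v) : u = v ∨ (u = 0 ∧ v = 1) := by
  rcases hv.lt_or_eq with hv | rfl
  · exact Or.inl (hf.injOn ⟨hu, huv.trans_lt hv⟩ ⟨hu.trans huv, hv⟩ h)
  · rcases huv.lt_or_eq with hu1 | hu1
    · rw [← hf.closed] at h
      exact Or.inr ⟨hf.injOn ⟨hu, hu1⟩ ⟨le_rfl, one_pos⟩ h, rfl⟩
    · exact Or.inl hu1

theorem IsJordanParam.isCompact_image (hf : IsJordanParam f γ) {a b : ℝ} (ha : 0 ≤ a)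
    (hb : b ≤ 1) : IsCompact (f '' Icc a b) :=
  isCompact_Icc.image_of_continuousOn (hf.continuousOn.mono (Icc_subset_Icc ha hb))

theorem IsJordanParam.isCompact (hf : IsJordanParam f γ) : IsCompact γ :=
  hf.image_eq ▸ hf.isCompact_image le_rfl le_rfl

theorem IsJordanParam.mem (hf : IsJordanParam f γ) {u : ℝ} (h0 : 0 ≤ u) (h1 : u ≤ 1) :
    f u ∈ γ := hf.image_eq ▸ mem_image_of_mem f ⟨h0, h1⟩

theorem IsJordanParam.subset_union (hf : IsJordanParam f γ) (a b : ℝ) :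
    γ ⊆ f '' Icc a b ∪ (f '' Icc 0 a ∪ f '' Icc b 1) := by
  rw [← hf.image_eq]
  rintro _ ⟨x, hx, rfl⟩
  rcases le_total x a with h | h
  · exact Or.inr (Or.inl ⟨x, ⟨hx.1, h⟩, rfl⟩)
  · rcases le_total x b with h' | h'
    · exact Or.inl ⟨x, ⟨h, h'⟩, rfl⟩
    · exact Or.inr (Or.inr ⟨x, ⟨h', hx.2⟩, rfl⟩)

theorem IsJordanParam.eq_or_eq_of_mem_arcs (hf : IsJordanParam f γ) {a b : ℝ} (ha : 0 ≤ a)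
    (hb : b ≤ 1) {w : Plane} (h1 : w ∈ f '' Icc a b)
    (h2 : w ∈ f '' Icc 0 a ∪ f '' Icc b 1) : w = f a ∨ w = f b := by
  obtain ⟨x, hx, rfl⟩ := h1
  rcases h2 with ⟨y, hy, hxy⟩ | ⟨y, hy, hxy⟩
  · rcases hf.eq_of_apply_eq hy.1 (hy.2.trans hx.1) (hx.2.trans hb) hxy with h | ⟨-, h⟩
    · left; rw [le_antisymm (h ▸ hy.2) hx.1]
    · right; rw [le_antisymm hx.2 (h ▸ hb)]
  · rcases hf.eq_of_apply_eq (ha.trans hx.1) (hx.2.trans hy.1) hy.2 hxy.symm with h | ⟨h, -⟩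
    · right; rw [le_antisymm hx.2 (h ▸ hy.1)]
    · left; rw [le_antisymm (h ▸ ha) hx.1]

/-- The subarcs cut out by a partition overlap in finitely many points, which are null for `μH[1]`,
so their measures add up; each chord is at most the measure of its subarc. -/
theorem IsJordanParam.eVariationOn_le (hf : IsJordanParam f γ) {a b : ℝ} (ha : 0 ≤ a)
    (hb : b ≤ 1) : eVariationOn f (Icc a b) ≤ μH[1] (f '' Icc a b) := by
  have := Measure.nullSingletonClass_hausdorff Plane (d := 1) one_pos
  refine iSup_le ?_
  rintro ⟨n, u, hu, hmem⟩
  dsimp only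
  have h0 : ∀ i, 0 ≤ u i := fun i => ha.trans (hmem i).1
  have h1 : ∀ i, u i ≤ 1 := fun i => (hmem i).2.trans hb
  have hlt : ∀ i j, i < j →
      AEDisjoint μH[1] (f '' Icc (u i) (u (i + 1))) (f '' Icc (u j) (u (j + 1))) := by
    intro i j hij
    refine measure_mono_null ?_ ((toFinite {f (u j), f 0}).measure_zero μH[1])
    rintro _ ⟨⟨x, hx, rfl⟩, ⟨y, hy, hxy⟩⟩
    have hxj : x ≤ u j := hx.2.trans (hu hij)
    rcases hf.eq_of_apply_eq ((h0 i).trans hx.1) (hxj.trans hy.1) (hy.2.trans (h1 _)) hxy.symm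
      with h | ⟨h, -⟩
    · left; rw [le_antisymm hxj (h ▸ hy.1)]
    · right; rw [h]; rfl
  calc ∑ i ∈ Finset.range n, edist (f (u (i + 1))) (f (u i))
      ≤ ∑ i ∈ Finset.range n, μH[1] (f '' Icc (u i) (u (i + 1))) :=
        Finset.sum_le_sum fun i _ => by
          rw [edist_comm]
          exact edist_le_hausdorffMeasure_image (hu i.le_succ)
            (hf.continuousOn.mono (Icc_subset_Icc (h0 i) (h1 _)))
    _ = μH[1] (⋃ i ∈ Finset.range n, f '' Icc (u i) (u (i + 1))) := by
        refine (measure_biUnion_finset₀ ?_ fun i _ =>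
          (hf.isCompact_image (h0 i) (h1 _)).measurableSet.nullMeasurableSet).symm
        intro i _ j _ hij
        rcases lt_or_gt_of_ne hij with h | h
        · exact hlt i j h
        · exact (hlt j i h).symm
    _ ≤ _ := measure_mono (iUnion₂_subset fun i _ =>
        image_mono (Icc_subset_Icc (hmem i).1 (hmem _).2))

/-- In `L`, the term `2n` serves pairs with `n|x - y| ≤ 2⁻ⁿ`, and `D n 2ⁿ` the remaining pairs,
where the diameter `D` is already a multiple of `|x - y|`. In the constant `2ML + 2`, the factor 2
counts the two parametric pieces of the arc through `f 0`, and the summand 2 ensures `c > 1`. -/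
theorem IsJordanParam.isChordArcCurve (hf : IsJordanParam f γ) {m n : ℕ}
    (hA : ¬ HasWideArcs f n) (hB : ¬ HasLargePacking γ m) : IsChordArcCurve γ := by
  obtain ⟨M, hM0, hM⟩ := exists_hausdorffMeasure_le hf.isCompact hB
  have hdiam : ∀ {u v : ℝ}, 0 ≤ u → u ≤ 1 → 0 ≤ v → v ≤ 1 → dist (f u) (f v) ≤ Metric.diam γ :=
    fun hu hu' hv hv' => Metric.dist_le_diam_of_mem hf.isCompact.isBounded (hf.mem hu hu')
      (hf.mem hv hv')
  set D := Metric.diam γ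
  have hD : 0 ≤ D := Metric.diam_nonneg
  set L : ℝ := 2 * n + D * n * 2 ^ n with hL
  have hL0 : 0 ≤ L := by positivity
  have harc : ∀ s t : ℝ, 0 ≤ s → s ≤ t → t ≤ 1 →
      (∀ u ∈ Icc s t, dist (f s) (f u) ≤ L * dist (f s) (f t)) ∨
      ∀ v ∈ Icc 0 s ∪ Icc t 1, dist (f s) (f v) ≤ L * dist (f s) (f t) := by
    intro s t hs hst ht
    have hr := dist_nonneg (x := f s) (y := f t)
    rcases le_or_gt (n * dist (f s) (f t)) ((1 / 2) ^ n) with h | h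
    · have hle : 2 * (n * dist (f s) (f t)) ≤ L * dist (f s) (f t) := by
        have : 0 ≤ D * n * 2 ^ n * dist (f s) (f t) := by positivity
        rw [hL, add_mul]
        linarith
      by_contra! hcon
      obtain ⟨⟨u, hu, hu'⟩, v, hv, hv'⟩ := hcon
      exact hA ⟨s, t, hs, hst, ht, h, ⟨u, hu, hle.trans_lt hu'⟩, v, hv, hle.trans_lt hv'⟩
    · left
      intro u hu
      have h1 : 1 ≤ n * dist (f s) (f t) * 2 ^ n := by
        rw [one_div, inv_pow, inv_lt_iff_one_lt_mul₀ (by positivity)] at h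
        linarith
      calc dist (f s) (f u) ≤ D := hdiam hs (hst.trans ht) (hs.trans hu.1) (hu.2.trans ht)
        _ ≤ D * (n * dist (f s) (f t) * 2 ^ n) := le_mul_of_one_le_right hD h1
        _ = D * n * 2 ^ n * dist (f s) (f t) := by ring
        _ ≤ L * dist (f s) (f t) := by gcongr; rw [hL]; linarith [n.cast_nonneg (α := ℝ)]
  have hvar : ∀ s a b R : ℝ, 0 ≤ a → b ≤ 1 → 0 ≤ R → (∀ u ∈ Icc a b, dist (f s) (f u) ≤ R) →
      eVariationOn f (Icc a b) ≤ ENNReal.ofReal (M * R) := by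
    intro s a b R ha hb hR h
    refine (hf.eVariationOn_le ha hb).trans ((measure_mono ?_).trans (hM (f s) R hR))
    rintro _ ⟨u, hu, rfl⟩
    exact ⟨hf.mem (ha.trans hu.1) (hu.2.trans hb), by
      rw [Metric.mem_closedBall, dist_comm]; exact h u hu⟩
  refine ⟨f, hf, ?_, 2 * (M * L) + 2, by nlinarith [mul_nonneg hM0 hL0], ?_⟩
  · exact ((hvar 0 0 1 D le_rfl le_rfl hD fun u hu =>
      hdiam le_rfl zero_le_one hu.1 hu.2).trans_lt ENNReal.ofReal_lt_top).ne
  · intro s t hs hst ht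
    have hr := dist_nonneg (x := f s) (y := f t)
    have hML : 0 ≤ M * (L * dist (f s) (f t)) := by positivity
    rcases harc s t hs hst ht with h | h
    · refine (min_le_left _ _).trans ((hvar s s t _ hs ht (by positivity) h).trans
        (ENNReal.ofReal_le_ofReal ?_))
      linarith
    · refine (min_le_right _ _).trans ((add_le_add
        (hvar s t 1 _ (hs.trans hst) le_rfl (by positivity) fun u hu => h u (Or.inr hu))
        (hvar s 0 s _ le_rfl (hst.trans ht) (by positivity) fun u hu => h u (Or.inl hu))).trans ?_)
      rw [← ENNReal.ofReal_add hML hML]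
      exact ENNReal.ofReal_le_ofReal (by linarith)

/-- Two points with wide arcs split the curve into two compact pieces that meet only far away. -/
theorem IsJordanParam.exists_pieces (hf : IsJordanParam f γ) {n : ℕ} (h : HasWideArcs f n) :
    ∃ (x y : Plane) (K₁ K₂ : Set Plane), IsCompact K₁ ∧ IsCompact K₂ ∧ γ ⊆ K₁ ∪ K₂ ∧ x ∈ K₁ ∧
      x ∈ γ ∧ y ∈ γ ∧ x ≠ y ∧ y ∈ K₂ ∧ (∀ w ∈ K₁, w ∈ K₂ → 2 * (n * dist x y) < dist x w) ∧
      n * dist x y ≤ (1 / 2) ^ n := by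
  obtain ⟨s, t, hs, hst, ht, hle, ⟨u, hu, hfu⟩, v, hv, hfv⟩ := h
  have hne : f s ≠ f t := by
    intro heq
    rw [← heq, dist_self, mul_zero, mul_zero, dist_pos] at hfu hfv
    rcases hf.eq_of_apply_eq hs hst ht heq with rfl | ⟨rfl, rfl⟩
    · exact hfu (congrArg f (le_antisymm hu.1 hu.2))
    · rcases hv with hv | hv
      · exact hfv (congrArg f (le_antisymm hv.1 hv.2))
      · exact hfv (hf.closed.trans (congrArg f (le_antisymm hv.1 hv.2)))
  have hu0 : 0 ≤ u := hs.trans hu.1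
  have hu1 : u ≤ 1 := hu.2.trans ht
  have hxs := hf.mem hs (hst.trans ht)
  have hyt := hf.mem (hs.trans hst) ht
  -- The curve is cut at the far points `f u` and `f v`, not at `x` and `y`: the pieces meet only at
  -- these cuts, and `u`, `v` separate the parameters `s`, `t` on the circle.
  rcases hv with hv | hv
  · refine ⟨f s, f t, f '' Icc v u, f '' Icc 0 v ∪ f '' Icc u 1, hf.isCompact_image hv.1 hu1,
      (hf.isCompact_image le_rfl (hv.2.trans (hst.trans ht))).union (hf.isCompact_image hu0 le_rfl),
      hf.subset_union v u, ⟨s, ⟨hv.2, hu.1⟩, rfl⟩, hxs, hyt, hne,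
      Or.inr ⟨t, ⟨hu.2, ht⟩, rfl⟩, fun w h1 h2 => ?_, hle⟩
    rcases hf.eq_or_eq_of_mem_arcs hv.1 hu1 h1 h2 with rfl | rfl
    exacts [hfv, hfu]
  · refine ⟨f s, f t, f '' Icc 0 u ∪ f '' Icc v 1, f '' Icc u v,
      (hf.isCompact_image le_rfl hu1).union
        (hf.isCompact_image (hs.trans (hst.trans hv.1)) le_rfl),
      hf.isCompact_image hu0 hv.2, union_comm _ _ ▸ hf.subset_union u v,
      Or.inl ⟨s, ⟨hs, hu.1⟩, rfl⟩, hxs, hyt, hne, ⟨t, ⟨hu.2, hv.1⟩, rfl⟩, fun w h1 h2 => ?_, hle⟩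
    rcases hf.eq_or_eq_of_mem_arcs hu0 hv.2 h2 h1 with rfl | rfl
    exacts [hfu, hfv]

end JordanParam

/-! ### Choice of one gauge for all scales, and conclusion. -/

theorem exists_gauge_of_hasWideArcs {Ω : Set Plane} {f : ℝ → Plane}
    (hf : IsJordanParam f (frontier Ω)) (h : ∀ n, HasWideArcs f n) :
    ∃ φ : ℝ≥0 ≃ₜ ℝ≥0, IsGauge φ ∧
      ¬ QuasisymmetricTo (surface Ω φ) (Metric.sphere (0 : Space) 1) := by
  have key : ∀ n : ℕ, ∃ δ : ℝ≥0, 0 < δ ∧ (0 < n → ∀ φ : ℝ≥0 ≃ₜ ℝ≥0, φ 0 = 0 → StrictMono φ →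
      (1 / 2 : ℝ) ^ n ≤ φ δ → ∀ (h : surface Ω φ ≃ₜ Metric.sphere (0 : Space) 1) (η : ℝ≥0 → ℝ≥0),
      (∀ (x a b : surface Ω φ) (t : ℝ≥0), 0 < t → dist x a ≤ t * dist x b →
        dist (h x) (h a) ≤ η t * dist (h x) (h b)) →
      ∀ t : ℝ≥0, 0 < t → η t < 1 / 2 → n * t < 1) := by
    intro n
    rcases n.eq_zero_or_pos with rfl | hn
    · exact ⟨1, one_pos, fun h => absurd h (lt_irrefl 0)⟩
    · obtain ⟨x, y, K₁, K₂, h₁, h₂, hΓ, hx₁, hx, hy, hxy, hy₂, hdisj, hle⟩ :=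
        hf.exists_pieces (h n)
      obtain ⟨δ, hδ, H⟩ := exists_delta_turning h₁ h₂ hΓ hx₁ hx hy hxy hn hy₂ hdisj hle
      exact ⟨δ, hδ, fun _ => H⟩
  choose δ hδ H using key
  obtain ⟨φ, hφ, hmono, hφδ⟩ := exists_gauge δ hδ
  refine ⟨φ, hφ, ?_⟩
  rintro ⟨g, η, hη⟩
  obtain ⟨t, ht, ht2⟩ : ∃ t : ℝ≥0, 0 < t ∧ η t < 1 / 2 := by
    -- `η 0 = 0` is not part of the definition. If `η.symm 0 = 0`, the preimage of `1/4` is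
    -- positive; otherwise `η.symm 0` itself serves.
    rcases (zero_le : 0 ≤ η.symm 0).eq_or_lt with h0 | h0
    · refine ⟨η.symm (1 / 4), lt_of_le_of_ne zero_le fun h4 => ?_, ?_⟩
      · have := η.symm.injective (h0.symm.trans h4)
        norm_num at this
      · rw [η.apply_symm_apply, ← NNReal.coe_lt_coe]
        norm_num
    · exact ⟨η.symm 0, h0, by rw [η.apply_symm_apply]; positivity⟩
  obtain ⟨n, hn⟩ := exists_nat_ge (1 / t)
  have h1 := H (n + 1) n.succ_pos φ hφ.map_zero hmono (hφδ _) g η hη t ht ht2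
  rw [div_le_iff₀ ht] at hn
  have h2 : (n : ℝ≥0) * t ≤ ((n + 1 : ℕ) : ℝ≥0) * t := by gcongr; exact n.le_succ
  exact absurd (hn.trans h2) (not_le.2 h1)

theorem exists_gauge_of_hasLargePacking {Ω : Set Plane} (hΩ : IsOpen Ω)
    (h : ∀ n, HasLargePacking (frontier Ω) n) :
    ∃ φ : ℝ≥0 ≃ₜ ℝ≥0, IsGauge φ ∧
      ¬ QuasisymmetricTo (surface Ω φ) (Metric.sphere (0 : Space) 1) := by
  choose p s d P hs hsd hd hPΩ hPd hPs hcard using h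
  choose δ hδ H using fun n => exists_delta_packing hΩ (hs n) (hsd n) (P n) (hPΩ n) (hPd n) (hPs n)
  obtain ⟨φ, hφ, hmono, hφδ⟩ := exists_gauge δ hδ
  refine ⟨φ, hφ, ?_⟩
  rintro ⟨g, η, hη⟩
  -- A single `E` bounds the distortion at every scale, so the packing constants are at most `3456
  -- E⁶`, while they exceed every `n`.
  set E : ℝ := 1 + η 4 + η 8
  obtain ⟨n, hn⟩ := exists_nat_ge (3456 * E ^ 6)
  have h4 := (η 4).coe_nonneg
  have h8 := (η 8).coe_nonneg
  have h1 := H n φ hmono ((hd n).trans (hφδ n)) g η hη E (by linarith) (by linarith) (by linarith)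
  have h2 := mul_le_mul_of_nonneg_right hn ((hs n).le.trans (hsd n))
  linarith [hcard n]

end DoubleDome

theorem mainTheorem9 (Ω : Set DoubleDome.Plane) (hΩ : DoubleDome.IsQuasidisk Ω)
    (hΓ : ¬ DoubleDome.IsChordArcCurve (frontier Ω)) :
    ∃ φ : ℝ≥0 ≃ₜ ℝ≥0, DoubleDome.IsGauge φ ∧
      ¬ DoubleDome.QuasisymmetricTo (DoubleDome.surface Ω φ)
        (Metric.sphere (0 : DoubleDome.Space) 1) := by
  obtain ⟨f, hf⟩ := hΩ.1.isJordanCurve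
  by_cases hA : ∀ n, DoubleDome.HasWideArcs f n
  · exact DoubleDome.exists_gauge_of_hasWideArcs hf hA
  by_cases hB : ∀ n, DoubleDome.HasLargePacking (frontier Ω) n
  · exact DoubleDome.exists_gauge_of_hasLargePacking hΩ.1.isOpen hB
  push Not at hA hB
  obtain ⟨n, hn⟩ := hA
  obtain ⟨m, hm⟩ := hB
  exact absurd (hf.isChordArcCurve hn hm) hΓ
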